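/- Let $F_j$ and $L_j$ denote the Fibonacci and Lucas numbers ($F_0=0$, $F_1=1$, $L_0=2$, $L_1=1$, $X_{j+2}=X_{j+1}+X_j$), and let $\sqrt[3]{\cdot}$ be the real cube root. Let $m$ and $n$ be positive integers. Then each of the following series converges absolutely, with the stated sum. (1) If $n>m$ and $(n,m)\neq(3,1)$, then $$\sum_{k=1}^\infty \frac{(-1)^{k(n-m-1)}}{k^2\binom{3k}{k}}\left(\frac{27F_n^2F_m^2}{F_{n-m}^2F_{n+m}^2}\right)^{k} = 6\arctan^2\!\left(\frac{\sqrt3\,\sqrt[3]{F_m^2}}{2\sqrt[3]{F_n^2}+(-1)^{n-m}\sqrt[3]{F_m^2}}\right)-\frac12\log^2\!\left(\frac{F_{n-m}F_{n+m}}{\big(\sqrt[3]{F_n^2}-(-1)^{n-m}\sqrt[3]{F_m^2}\big)^3}\right).$$ (2) If $n\ge m$, and either $m\ge2$ or $n=m=1$, then $$\sum_{k=1}^\infty \frac{(-1)^{km}}{k^2\binom{3k}{k}}\left(\frac{27F_{n+m}F_{n-m}}{L_m^2F_n^2}\right)^{k} = 6\arctan^2\!\left(\frac{\sqrt3\,\sqrt[3]{F_{n-m}}}{2\sqrt[3]{F_{n+m}}-(-1)^m\sqrt[3]{F_{n-m}}}\right)-\frac12\log^2\!\left(\frac{L_mF_n}{\big(\sqrt[3]{F_{n+m}}+(-1)^m\sqrt[3]{F_{n-m}}\big)^3}\right).$$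 (3) If $n\ge m$ and $(n,m)\neq(3,2)$, then $$\sum_{k=1}^\infty \frac{(-1)^{k(m-1)}}{k^2\binom{3k}{k}}\left(\frac{27F_{n+m}F_{n-m}}{F_m^2L_n^2}\right)^{k} = 6\arctan^2\!\left(\frac{\sqrt3\,\sqrt[3]{F_{n-m}}}{2\sqrt[3]{F_{n+m}}+(-1)^m\sqrt[3]{F_{n-m}}}\right)-\frac12\log^2\!\left(\frac{F_mL_n}{\big(\sqrt[3]{F_{n+m}}-(-1)^m\sqrt[3]{F_{n-m}}\big)^3}\right).$$ (4) If $\frac{L_n}{L_m}>\frac{F_n}{F_m}$ (in either order of $m$ and $n$), then $$\sum_{k=1}^\infty \frac{1}{k^2\binom{3k}{k}}\left(\frac{27}{4}\,\frac{F_{2m}F_{2n}}{F_{n+m}^2}\right)^{k} = 6\arctan^2\!\left(\frac{\sqrt3\,\sqrt[3]{L_mF_n}}{2\sqrt[3]{L_nF_m}-\sqrt[3]{L_mF_n}}\right)-\frac12\log^2\!\left(\frac{2F_{n+m}}{\big(\sqrt[3]{L_nF_m}+\sqrt[3]{L_mF_n}\big)^3}\right).$$ (5) If $n\ge m\ge2$,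 then $$\sum_{k=1}^\infty \frac{(-1)^{km}}{k^2\binom{3k}{k}}\left(\frac{27L_{n+m}L_{n-m}}{L_m^2L_n^2}\right)^{k} = 6\arctan^2\!\left(\frac{\sqrt3\,\sqrt[3]{L_{n-m}}}{2\sqrt[3]{L_{n+m}}-(-1)^m\sqrt[3]{L_{n-m}}}\right)-\frac12\log^2\!\left(\frac{L_mL_n}{\big(\sqrt[3]{L_{n+m}}+(-1)^m\sqrt[3]{L_{n-m}}\big)^3}\right).$$ (6) If $n\ge m$ and $(n,m)\neq(2,2)$, then $$\sum_{k=1}^\infty \frac{(-1)^{k(m-1)}}{k^2\binom{3k}{k}}\left(\frac{27L_{n+m}L_{n-m}}{25F_m^2F_n^2}\right)^{k} = 6\arctan^2\!\left(\frac{\sqrt3\,\sqrt[3]{L_{n-m}}}{2\sqrt[3]{L_{n+m}}+(-1)^m\sqrt[3]{L_{n-m}}}\right)-\frac12\log^2\!\left(\frac{5F_mF_n}{\big(\sqrt[3]{L_{n+m}}-(-1)^m\sqrt[3]{L_{n-m}}\big)^3}\right).$$ (The pairs excluded in (1), (2), (3), (5) and (6) are exactly those for which the series diverges.) -/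

import Mathlib

/-- The Lucas numbers as natural numbers: `2, 1, 3, 4, 7, 11, …`. -/
def lucasNat : ℕ → ℕ
  | 0 => 2
  | 1 => 1
  | j + 2 => lucasNat (j + 1) + lucasNat j

/-- The `j`-th Fibonacci number, as a real number. -/
noncomputable def fibR (j : ℕ) : ℝ := (Nat.fib j : ℝ)

/-- The `j`-th Lucas number, as a real number. -/
noncomputable def lucR (j : ℕ) : ℝ := (lucasNat j : ℝ)

/-- The real cube root of a real number `x ≥ 0` (it is only applied to such numbers). -/
noncomputable def cbrt (x : ℝ) : ℝ := x ^ ((1 : ℝ) / 3)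

/-! All six series are values of f(x) = ∑ x^k / (k² binom(3k,k)). Parametrise x = 27s³/(1+s³)²; then
f(x) equals `closedForm s`. The beta integral turns f' into ∫₀¹ y²/(1 - x(1-y)y²) dy. In the
parameter s the cubic denominator splits into a linear and a quadratic factor, so the integral is
elementary (`seriesArg_mul_integral`). Hence f(x(s)) and `closedForm s` have equal derivatives along
the segment from 0 to s, and both vanish at 0 (`invChooseSeries_seriesArg`). The endpoint s = 1, x =
27/4, follows by monotone passage to the limit (`hasSum_closedForm_one`). Taking s³ = εB/A with ε =
±1 gives x = ε·27AB/(A+εB)². Each case of the theorem is then an identity A + εB = C between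
Fibonacci and Lucas numbers, plus |x| ≤ 27/4. For ε = 1 this only needs B ≤ A; for ε = -1 the bound
B/A ≤ 1/6 < 3 - 2√2 suffices. The growth estimates supply it outside the excluded pairs. -/

/-! ### The power series and the integral for its derivative. -/

/-- The beta integral at natural exponents. -/
theorem integral_pow_mul_one_sub_pow (a b : ℕ) :
    ∫ y in (0 : ℝ)..1, y ^ a * (1 - y) ^ b
      = (a.factorial : ℝ) * b.factorial / (a + b + 1).factorial := by
  induction b generalizing a with
  | zero =>
    simp only [pow_zero, mul_one, integral_pow, Nat.factorial_zero, Nat.cast_one, add_zero,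
      Nat.factorial_succ, one_pow]
    have : (a.factorial : ℝ) ≠ 0 := by positivity
    push_cast
    field_simp
    simp
  | succ b ih =>
    have hd : ∀ y ∈ Set.uIcc (0 : ℝ) 1, HasDerivAt (fun y : ℝ => y ^ (a + 1) * (1 - y) ^ (b + 1))
        ((a + 1) * (y ^ a * (1 - y) ^ (b + 1)) - (b + 1) * (y ^ (a + 1) * (1 - y) ^ b)) y := by
      intro y _
      have h1 := hasDerivAt_pow (a + 1) y
      have h2 := ((hasDerivAt_id y).const_sub 1).pow (b + 1)
      refine (h1.mul h2).congr_deriv ?_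
      simp only [id, Nat.add_sub_cancel, Pi.pow_apply]
      push_cast
      ring
    have h := intervalIntegral.integral_eq_sub_of_hasDerivAt hd
      (Continuous.intervalIntegrable (by fun_prop) _ _)
    rw [intervalIntegral.integral_sub (Continuous.intervalIntegrable (by fun_prop) _ _)
      (Continuous.intervalIntegrable (by fun_prop) _ _), intervalIntegral.integral_const_mul,
      intervalIntegral.integral_const_mul, ih (a + 1)] at h
    simp only [one_pow, sub_self, ne_eq, Nat.succ_ne_zero, not_false_eq_true, zero_pow, mul_zero,
      zero_mul] at h
    have e : a + 1 + b + 1 = a + (b + 1) + 1 := by ring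
    rw [e, Nat.factorial_succ a] at h
    rw [Nat.factorial_succ b]
    push_cast at h ⊢
    have ha : (a : ℝ) + 1 ≠ 0 := by positivity
    apply mul_left_cancel₀ ha
    linear_combination h

/-- The coefficient `1 / ((j + 1) ^ 2 * (3 j + 3).choose (j + 1))`. -/
noncomputable def invChooseCoeff (j : ℕ) : ℝ :=
  1 / (((j : ℝ) + 1) ^ 2 * (Nat.choose (3 * (j + 1)) (j + 1) : ℝ))

theorem invChooseCoeff_nonneg (j : ℕ) : 0 ≤ invChooseCoeff j := by
  unfold invChooseCoeff; positivity

theorem invChooseCoeff_mul_eq_integral (j : ℕ) :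
    invChooseCoeff j * (j + 1) = ∫ y in (0 : ℝ)..1, y ^ (2 * j + 2) * (1 - y) ^ j := by
  rw [integral_pow_mul_one_sub_pow, invChooseCoeff, Nat.cast_choose ℝ (by omega)]
  have e1 : 3 * (j + 1) - (j + 1) = 2 * j + 2 := by omega
  have e2 : 2 * j + 2 + j + 1 = 3 * (j + 1) := by omega
  rw [e1, e2, Nat.factorial_succ j]
  push_cast
  have h1 : (j.factorial : ℝ) ≠ 0 := by positivity
  have h2 : ((2 * j + 2).factorial : ℝ) ≠ 0 := by positivity
  have h3 : ((3 * (j + 1)).factorial : ℝ) ≠ 0 := by positivity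
  field_simp

theorem one_sub_mul_sq_mem {y : ℝ} (hy : y ∈ Set.Icc (0 : ℝ) 1) :
    0 ≤ (1 - y) * y ^ 2 ∧ (1 - y) * y ^ 2 ≤ 4 / 27 := by
  obtain ⟨h0, h1⟩ := hy
  constructor
  · have : 0 ≤ 1 - y := by linarith
    positivity
  -- The maximum is at y = 2/3: 4 - 27(1-y)y² = (3y-2)²(3y+1).
  · nlinarith [mul_nonneg (sq_nonneg (3 * y - 2)) (by linarith : 0 ≤ 3 * y + 1)]

theorem abs_mul_one_sub_mul_sq_le {x y : ℝ} (hy : y ∈ Set.Icc (0 : ℝ) 1) :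
    |x * ((1 - y) * y ^ 2)| ≤ |x| * (4 / 27) := by
  obtain ⟨h0, h1⟩ := one_sub_mul_sq_mem hy
  rw [abs_mul, abs_of_nonneg h0]
  gcongr

theorem hasSum_invChooseCoeff_deriv {x : ℝ} (hx : |x| < 27 / 4) :
    HasSum (fun j : ℕ => invChooseCoeff j * (j + 1) * x ^ j)
      (∫ y in (0 : ℝ)..1, y ^ 2 / (1 - x * ((1 - y) * y ^ 2))) := by
  have hr : |x| * (4 / 27) < 1 := by linarith
  have hr0 : 0 ≤ |x| * (4 / 27) := by positivity
  have hsub : ∀ y ∈ Set.uIoc (0 : ℝ) 1, y ∈ Set.Icc (0 : ℝ) 1 := fun y hy => by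
    rw [Set.uIoc_of_le zero_le_one] at hy
    exact ⟨hy.1.le, hy.2⟩
  have h := intervalIntegral.hasSum_integral_of_dominated_convergence
    (μ := MeasureTheory.volume) (a := (0 : ℝ)) (b := 1)
    (F := fun (j : ℕ) (y : ℝ) => y ^ 2 * (x * ((1 - y) * y ^ 2)) ^ j)
    (f := fun y => y ^ 2 / (1 - x * ((1 - y) * y ^ 2)))
    (fun j _ => (|x| * (4 / 27)) ^ j)
    (fun j => (Continuous.aestronglyMeasurable (by fun_prop)))
    (fun j => Filter.Eventually.of_forall fun y hy => ?_)
    (Filter.Eventually.of_forall fun y _ => summable_geometric_of_lt_one hr0 hr)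
    (by simp)
    (Filter.Eventually.of_forall fun y hy => ?_)
  · refine h.congr_fun fun j => ?_
    rw [invChooseCoeff_mul_eq_integral, ← intervalIntegral.integral_mul_const]
    congr 1
    ext y
    rw [mul_pow, mul_pow]
    ring
  · have hy' := hsub y hy
    rw [Real.norm_eq_abs, abs_mul, abs_pow, abs_pow]
    have h1 : |y| ^ 2 ≤ 1 := by
      rw [abs_of_nonneg hy'.1]; exact pow_le_one₀ hy'.1 hy'.2
    calc |y| ^ 2 * |x * ((1 - y) * y ^ 2)| ^ j ≤ 1 * (|x| * (4 / 27)) ^ j := by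
          gcongr
          exact abs_mul_one_sub_mul_sq_le hy'
      _ = _ := one_mul _
  · have hy' := hsub y hy
    rw [div_eq_mul_inv]
    refine HasSum.mul_left _ (hasSum_geometric_of_abs_lt_one ?_)
    exact (abs_mul_one_sub_mul_sq_le hy').trans_lt hr

/-- The function `∑ x ^ k / (k ^ 2 * (3 k).choose k)`. -/
noncomputable def invChooseSeries (x : ℝ) : ℝ := ∑' j : ℕ, invChooseCoeff j * x ^ (j + 1)

theorem summable_invChooseCoeff {x : ℝ} (hx : |x| < 27 / 4) :
    Summable fun j : ℕ => invChooseCoeff j * x ^ (j + 1) := by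
  have h := (hasSum_invChooseCoeff_deriv (x := |x|) (by rwa [abs_abs])).summable.mul_left |x|
  refine Summable.of_norm_bounded h fun j => ?_
  rw [Real.norm_eq_abs, abs_mul, abs_pow, abs_of_nonneg (invChooseCoeff_nonneg j), pow_succ]
  have := invChooseCoeff_nonneg j
  have h2 : 0 ≤ |x| * (invChooseCoeff j * j * |x| ^ j) := by positivity
  nlinarith

theorem hasDerivAt_invChooseSeries {x : ℝ} (hx : |x| < 27 / 4) :
    HasDerivAt invChooseSeries (∫ y in (0 : ℝ)..1, y ^ 2 / (1 - x * ((1 - y) * y ^ 2))) x := by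
  obtain ⟨r, hxr, hr⟩ := exists_between hx
  have hr0 : 0 < r := (abs_nonneg x).trans_lt hxr
  have hs : Summable fun j : ℕ => invChooseCoeff j * (j + 1) * r ^ j :=
    (hasSum_invChooseCoeff_deriv (x := r) (by rwa [abs_of_pos hr0])).summable
  have hd : ∀ (j : ℕ) (y : ℝ), y ∈ Set.Ioo (-r) r →
      HasDerivAt (fun y : ℝ => invChooseCoeff j * y ^ (j + 1))
        (invChooseCoeff j * (j + 1) * y ^ j) y := by
    intro j y _
    refine ((hasDerivAt_pow (j + 1) y).const_mul _).congr_deriv ?_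
    push_cast
    ring
  have hb : ∀ (j : ℕ) (y : ℝ), y ∈ Set.Ioo (-r) r →
      ‖invChooseCoeff j * (j + 1) * y ^ j‖ ≤ invChooseCoeff j * (j + 1) * r ^ j := by
    intro j y hy
    have := invChooseCoeff_nonneg j
    rw [Real.norm_eq_abs, abs_mul, abs_pow, abs_of_nonneg (by positivity)]
    gcongr
    exact (abs_lt.2 hy).le
  have h0 : Summable fun j : ℕ => invChooseCoeff j * (0 : ℝ) ^ (j + 1) :=
    summable_invChooseCoeff (by rw [abs_zero]; norm_num)
  have h := hasDerivAt_tsum_of_isPreconnected hs isOpen_Ioo isPreconnected_Ioo hd hb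
    (y₀ := 0) ⟨by linarith, hr0⟩ h0 (abs_lt.1 hxr)
  rw [(hasSum_invChooseCoeff_deriv hx).tsum_eq] at h
  exact h

/-! ### Arctangent derivatives and a tripling identity. -/

theorem hasDerivAt_arctan_div_sqrt_three_mul {N M : ℝ → ℝ} {N' M' s : ℝ} (hN : HasDerivAt N N' s)
    (hM : HasDerivAt M M' s) (h0 : M s ≠ 0) :
    HasDerivAt (fun t => Real.arctan (N t / (√3 * M t)))
      (√3 * (N' * M s - N s * M') / (3 * M s ^ 2 + N s ^ 2)) s := by
  have h3 : √(3 : ℝ) ≠ 0 := by positivity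
  have h3' : √(3 : ℝ) ^ 2 = 3 := Real.sq_sqrt (by norm_num)
  refine ((hN.div (hM.const_mul √3) (mul_ne_zero h3 h0)).arctan).congr_deriv ?_
  have hp : 0 < M s ^ 2 := by positivity
  have e : 1 + (N s / (√3 * M s)) ^ 2 = (3 * M s ^ 2 + N s ^ 2) / (3 * M s ^ 2) := by
    rw [div_pow, mul_pow, h3']; field_simp
  have h4 : 3 * M s ^ 2 + N s ^ 2 ≠ 0 := by positivity
  simp only [Pi.div_apply]
  rw [e, mul_pow, h3']
  field_simp

theorem hasDerivAt_arctan_parameter {s : ℝ} (hs : s < 2) :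
    HasDerivAt (fun t : ℝ => Real.arctan (√3 * t / (2 - t))) (√3 / (2 * (1 - s + s ^ 2))) s := by
  have h3 : √(3 : ℝ) ≠ 0 := by positivity
  have h3' : √(3 : ℝ) ^ 2 = 3 := Real.sq_sqrt (by norm_num)
  have e : (fun t : ℝ => Real.arctan (√3 * t / (2 - t)))
      = fun t : ℝ => Real.arctan (3 * t / (√3 * (2 - t))) := by
    ext t
    congr 1
    have e3 : 3 * t = √3 * (√3 * t) := by rw [← mul_assoc, ← sq, h3']
    rw [e3, mul_div_mul_left _ _ h3]
  rw [e]
  have h := hasDerivAt_arctan_div_sqrt_three_mul ((hasDerivAt_id s).const_mul 3)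
    ((hasDerivAt_id s).const_sub 2) (by simp only [id]; linarith)
  refine h.congr_deriv ?_
  simp only [id]
  have hp : 0 < 1 - s + s ^ 2 := by nlinarith [sq_nonneg (s - 1)]
  have h4 : 3 * (2 - s) ^ 2 + (3 * s) ^ 2 = 12 * (1 - s + s ^ 2) := by ring
  rw [h4]
  field_simp
  ring

/-- The left side is the difference of boundary values at y = 1 and y = 0 of the arctangent in
`seriesArg_mul_integral`. Both sides vanish at s = 0 and have the same derivative, which avoids the
branch conditions of the addition formula. -/
theorem arctan_add_arctan_eq_three_mul {s : ℝ} (hs : s ∈ Set.Ioo (-1 : ℝ) 1) :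
    Real.arctan ((6 * s - (1 + s) ^ 2) / (√3 * (1 - s ^ 2)))
      + Real.arctan ((1 + s) ^ 2 / (√3 * (1 - s ^ 2))) = 3 * Real.arctan (√3 * s / (2 - s)) := by
  have hd : ∀ t ∈ Set.Ioo (-1 : ℝ) 1, HasDerivAt (fun s : ℝ =>
      Real.arctan ((6 * s - (1 + s) ^ 2) / (√3 * (1 - s ^ 2)))
      + Real.arctan ((1 + s) ^ 2 / (√3 * (1 - s ^ 2))) - 3 * Real.arctan (√3 * s / (2 - s))) 0 t := by
    intro t ht
    have hM0 : 0 < 1 - t ^ 2 := by nlinarith [ht.1, ht.2]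
    have hM : HasDerivAt (fun s : ℝ => 1 - s ^ 2) (-(2 * t)) t := by
      simpa using (hasDerivAt_pow 2 t).const_sub 1
    have hN2 : HasDerivAt (fun s : ℝ => (1 + s) ^ 2) (2 * (1 + t)) t := by
      exact (((hasDerivAt_id t).const_add 1).pow 2).congr_deriv (by simp)
    have hN1 : HasDerivAt (fun s : ℝ => 6 * s - (1 + s) ^ 2) (6 - 2 * (1 + t)) t := by
      exact (((hasDerivAt_id t).const_mul 6).sub hN2).congr_deriv (by simp)
    have h := ((hasDerivAt_arctan_div_sqrt_three_mul hN1 hM hM0.ne').add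
      (hasDerivAt_arctan_div_sqrt_three_mul hN2 hM hM0.ne')).sub
      ((hasDerivAt_arctan_parameter (by linarith [ht.2] : t < 2)).const_mul 3)
    refine h.congr_deriv ?_
    have hp : 0 < 1 - t + t ^ 2 := by nlinarith [sq_nonneg (t - 1)]
    have h1 : 0 < 1 + t := by linarith [ht.1]
    have e1 : 3 * (1 - t ^ 2) ^ 2 + (6 * t - (1 + t) ^ 2) ^ 2 = 4 * (1 - t + t ^ 2) ^ 2 := by ring
    have e2 : 3 * (1 - t ^ 2) ^ 2 + ((1 + t) ^ 2) ^ 2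
      = 4 * (1 + t) ^ 2 * (1 - t + t ^ 2) := by ring
    rw [e1, e2]
    field_simp
    ring
  have h := isOpen_Ioo.is_const_of_deriv_eq_zero isPreconnected_Ioo
    (fun t ht => (hd t ht).differentiableAt.differentiableWithinAt)
    (fun t ht => (hd t ht).deriv) hs (show (0 : ℝ) ∈ Set.Ioo (-1 : ℝ) 1 by norm_num)
  have h0 : Real.arctan ((6 * 0 - (1 + 0) ^ 2) / (√3 * (1 - 0 ^ 2)))
      + Real.arctan ((1 + 0) ^ 2 / (√3 * (1 - 0 ^ 2))) - 3 * Real.arctan (√3 * 0 / (2 - 0)) = 0 := by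
    simp [neg_div, Real.arctan_neg]
  linarith

/-! ### Parametrisation and evaluation of the integral. -/

/-- The argument `27 s ^ 3 / (1 + s ^ 3) ^ 2` of the series as a function of the parameter. -/
noncomputable def seriesArg (s : ℝ) : ℝ := 27 * s ^ 3 / (1 + s ^ 3) ^ 2

/-- The closed form of the series as a function of the parameter. -/
noncomputable def closedForm (s : ℝ) : ℝ :=
  6 * Real.arctan (√3 * s / (2 - s)) ^ 2 - 1 / 2 * Real.log ((1 + s ^ 3) / (1 + s) ^ 3) ^ 2

theorem one_add_cube_pos {s : ℝ} (hs : -1 < s) : 0 < 1 + s ^ 3 := by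
  have e : 1 + s ^ 3 = (1 + s) * (1 - s + s ^ 2) := by ring
  have : 0 < 1 - s + s ^ 2 := by nlinarith [sq_nonneg (s - 1)]
  have : 0 < 1 + s := by linarith
  rw [e]; positivity

theorem hasDerivAt_seriesArg {s : ℝ} (hs : -1 < s) :
    HasDerivAt seriesArg (81 * s ^ 2 * (1 - s ^ 3) / (1 + s ^ 3) ^ 3) s := by
  have hc := one_add_cube_pos hs
  have h1 : HasDerivAt (fun s : ℝ => s ^ 3) (3 * s ^ 2) s := by simpa using hasDerivAt_pow 3 s
  refine ((h1.const_mul 27).div ((h1.const_add 1).pow 2) (pow_pos hc 2).ne').congr_deriv ?_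
  simp only [Pi.pow_apply]
  field_simp
  ring

theorem hasDerivAt_closedForm {s : ℝ} (hs : s ∈ Set.Ioo (-1 : ℝ) 2) :
    HasDerivAt closedForm (3 / (1 + s ^ 3) * (2 * √3 * (1 + s) * Real.arctan (√3 * s / (2 - s))
      + (1 - s) * Real.log ((1 + s ^ 3) / (1 + s) ^ 3))) s := by
  have hc := one_add_cube_pos hs.1
  have h1s : 0 < 1 + s := by linarith [hs.1]
  have hp : 0 < 1 - s + s ^ 2 := by nlinarith [sq_nonneg (s - 1)]
  have h1 : HasDerivAt (fun s : ℝ => 1 + s ^ 3) (3 * s ^ 2) s := by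
    simpa using (hasDerivAt_pow 3 s).const_add 1
  have h2 : HasDerivAt (fun s : ℝ => (1 + s) ^ 3) (3 * (1 + s) ^ 2) s := by
    exact (((hasDerivAt_id s).const_add 1).pow 3).congr_deriv (by simp)
  have hl := (((h1.div h2 (by positivity)).log
    (by simp only [Pi.div_apply]; positivity)).pow 2).const_mul (1 / 2)
  have ha := ((hasDerivAt_arctan_parameter hs.2).pow 2).const_mul 6
  refine (ha.sub hl).congr_deriv ?_
  simp only [Pi.div_apply]
  generalize Real.arctan (√3 * s / (2 - s)) = A
  generalize Real.log ((1 + s ^ 3) / (1 + s) ^ 3) = B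
  have e : 1 + s ^ 3 = (1 + s) * (1 - s + s ^ 2) := by ring
  rw [e]
  field_simp
  ring

theorem seriesArg_mul_integral {s : ℝ} (hs : s ∈ Set.Ioo (-1 : ℝ) 1) :
    seriesArg s * ∫ y in (0 : ℝ)..1, y ^ 2 / (1 - seriesArg s * ((1 - y) * y ^ 2))
      = s / (1 - s ^ 3) * (2 * √3 * (1 + s) * Real.arctan (√3 * s / (2 - s))
      + (1 - s) * Real.log ((1 + s ^ 3) / (1 + s) ^ 3)) := by
  have h3 : √(3 : ℝ) ≠ 0 := by positivity
  have h3' : √(3 : ℝ) ^ 2 = 3 := Real.sq_sqrt (by norm_num)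
  have hc := one_add_cube_pos hs.1
  have h1s : 0 < 1 + s := by linarith [hs.1]
  have h1s' : 0 < 1 - s := by linarith [hs.2]
  -- Here 1 + s³ = (1+s)p and 1 - s³ = (1-s)q; both are kept opaque so that `field_simp` treats them
  -- as atoms.
  obtain ⟨p, hpdef⟩ : ∃ p, p = 1 - s + s ^ 2 := ⟨_, rfl⟩
  obtain ⟨q, hqdef⟩ : ∃ q, q = 1 + s + s ^ 2 := ⟨_, rfl⟩
  have hp : 0 < p := by nlinarith [sq_nonneg (s - 1)]
  have hq : 0 < q := by nlinarith [sq_nonneg (s + 1)]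
  have hM : 0 < 1 - s ^ 2 := by nlinarith
  have hlin : ∀ y ∈ Set.Icc (0 : ℝ) 1, 0 < 3 * s * y + p := by
    intro y hy
    have : 3 * s * y + p = y * (1 + s) ^ 2 + (1 - y) * p := by rw [hpdef]; ring
    rw [this]
    rcases hy.2.lt_or_eq with h | h
    · have := hy.1
      have : 0 < 1 - y := by linarith
      positivity
    · rw [h]; simp; positivity
  -- Completing the square: four times the quadratic is (2z - (1+s)²)² + 3(1-s²)² with z = 3sy.
  have hquad : ∀ y : ℝ, 0 < (3 * s * y) ^ 2 - (1 + s) ^ 2 * (3 * s * y) + (1 + s) ^ 2 * p := by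
    intro y
    have : 0 < (1 - s ^ 2) ^ 2 := by positivity
    rw [hpdef]
    nlinarith [sq_nonneg (2 * (3 * s * y) - (1 + s) ^ 2)]
  -- With z = 3sy the left side is z³ - 3sz² + (1+s³)², which has the root z = -p.
  have hden : ∀ y, (1 + s ^ 3) ^ 2 * (1 - seriesArg s * ((1 - y) * y ^ 2)) = (3 * s * y + p) *
      ((3 * s * y) ^ 2 - (1 + s) ^ 2 * (3 * s * y) + (1 + s) ^ 2 * p) := by
    intro y
    rw [seriesArg, hpdef]
    field_simp
    ring
  have hpos : ∀ y ∈ Set.Icc (0 : ℝ) 1, 0 < 1 - seriesArg s * ((1 - y) * y ^ 2) := by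
    intro y hy
    have h := mul_pos (hlin y hy) (hquad y)
    rw [← hden] at h
    exact pos_of_mul_pos_right h (by positivity)
  -- Partial fractions of z²/((z+p)Q(z)), Q being the quadratic factor. Since Q(-p) = 3pq, the
  -- residue at -p is p/(3q); the remaining coefficient 1 - p/(3q) = 2(1+s)²/(3q) is halved in front
  -- of log Q, and the rest is the arctangent.
  have hd : ∀ y ∈ Set.uIcc (0 : ℝ) 1, HasDerivAt (fun y : ℝ =>
      p / (3 * q) * Real.log (3 * s * y + p) + (1 + s) ^ 2 / (3 * q) *
        Real.log ((3 * s * y) ^ 2 - (1 + s) ^ 2 * (3 * s * y) + (1 + s) ^ 2 * p)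
      + 2 * s * (1 + s) / (√3 * (1 - s) * q) *
        Real.arctan ((2 * (3 * s * y) - (1 + s) ^ 2) / (√3 * (1 - s ^ 2))))
      (seriesArg s * (y ^ 2 / (1 - seriesArg s * ((1 - y) * y ^ 2)))) y := by
    intro y hy
    rw [Set.uIcc_of_le zero_le_one] at hy
    have hz : HasDerivAt (fun y : ℝ => 3 * s * y) (3 * s) y := by
      simpa using (hasDerivAt_id y).const_mul (3 * s)
    have hQ : HasDerivAt (fun y : ℝ =>
        (3 * s * y) ^ 2 - (1 + s) ^ 2 * (3 * s * y) + (1 + s) ^ 2 * p)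
        (2 * (3 * s * y) * (3 * s) - (1 + s) ^ 2 * (3 * s)) y := by
      simpa using ((hz.pow 2).sub (hz.const_mul ((1 + s) ^ 2))).add_const ((1 + s) ^ 2 * p)
    have h1 := ((hz.add_const p).log (hlin y hy).ne').const_mul (p / (3 * q))
    have h2 := (hQ.log (hquad y).ne').const_mul ((1 + s) ^ 2 / (3 * q))
    have h4 := (hasDerivAt_arctan_div_sqrt_three_mul
      ((hz.const_mul 2).sub_const ((1 + s) ^ 2)) (hasDerivAt_const y (1 - s ^ 2))
      hM.ne').const_mul (2 * s * (1 + s) / (√3 * (1 - s) * q))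
    refine ((h1.add h2).add h4).congr_deriv ?_
    have hl := hlin y hy
    have hq2 := hquad y
    have e1 : seriesArg s * (y ^ 2 / (1 - seriesArg s * ((1 - y) * y ^ 2)))
        = 27 * s ^ 3 * y ^ 2 / ((3 * s * y + p) *
      ((3 * s * y) ^ 2 - (1 + s) ^ 2 * (3 * s * y) + (1 + s) ^ 2 * p)) := by
      have hx : seriesArg s * (1 + s ^ 3) ^ 2 = 27 * s ^ 3 := by rw [seriesArg]; field_simp
      rw [← hden y, ← hx, mul_comm (seriesArg s) ((1 + s ^ 3) ^ 2), mul_assoc,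
        mul_div_mul_left _ _ (by positivity), mul_div_assoc]
    have e2 : 3 * (1 - s ^ 2) ^ 2 + (2 * (3 * s * y) - (1 + s) ^ 2) ^ 2
        = 4 * ((3 * s * y) ^ 2 - (1 + s) ^ 2 * (3 * s * y) + (1 + s) ^ 2 * p) := by
      rw [hpdef]; ring
    rw [e1, e2]
    have e3 : 1 - s ^ 2 = (1 - s) * (1 + s) := by ring
    have e4 : 3 * q - p = 2 * (1 + s) ^ 2 := by rw [hqdef, hpdef]; ring
    set Q := (3 * s * y) ^ 2 - (1 + s) ^ 2 * (3 * s * y) + (1 + s) ^ 2 * p with hQdef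
    set L := 3 * s * y + p with hLdef
    have e5 : √3 * (2 * (3 * s) * (1 - s ^ 2) - (2 * (3 * s * y) - (1 + s) ^ 2) * 0) / (4 * Q)
        = √3 * (3 * s * (1 - s) * (1 + s)) / (2 * Q) := by
      rw [e3]; field_simp; ring
    have e6 : 2 * s * (1 + s) / (√3 * (1 - s) * q) * (√3 * (3 * s * (1 - s) * (1 + s)) / (2 * Q))
        = 3 * s ^ 2 * (1 + s) ^ 2 / (q * Q) := by
      field_simp
    rw [e5, e6]
    field_simp
    rw [hQdef, hLdef, hqdef, hpdef]
    ring
  have hi : IntervalIntegrable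
      (fun y => seriesArg s * (y ^ 2 / (1 - seriesArg s * ((1 - y) * y ^ 2))))
      MeasureTheory.volume 0 1 := by
    refine ContinuousOn.intervalIntegrable (continuousOn_const.mul (ContinuousOn.div (by fun_prop)
      (by fun_prop) fun y hy => ?_))
    rw [Set.uIcc_of_le zero_le_one] at hy
    exact (hpos y hy).ne'
  have h := intervalIntegral.integral_eq_sub_of_hasDerivAt hd hi
  rw [intervalIntegral.integral_const_mul] at h
  rw [h]
  have e1 : 3 * s * 1 + p = (1 + s) ^ 2 := by rw [hpdef]; ring
  have e2 : (3 * s * 1) ^ 2 - (1 + s) ^ 2 * (3 * s * 1) + (1 + s) ^ 2 * p = p ^ 2 := by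
    rw [hpdef]; ring
  have e3 : (3 * s * 0) ^ 2 - (1 + s) ^ 2 * (3 * s * 0) + (1 + s) ^ 2 * p = (1 + s) ^ 2 * p := by
    ring
  have e4 : 3 * s * 0 + p = p := by ring
  have e5 : 2 * (3 * s * 1) - (1 + s) ^ 2 = 6 * s - (1 + s) ^ 2 := by ring
  have e6 : (2 * (3 * s * 0) - (1 + s) ^ 2) / (√3 * (1 - s ^ 2))
    = -((1 + s) ^ 2 / (√3 * (1 - s ^ 2))) := by rw [← neg_div]; ring
  have e7 : (1 + s ^ 3) / (1 + s) ^ 3 = p / (1 + s) ^ 2 := by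
    rw [hpdef]; field_simp; ring
  have e8 : 1 - s ^ 3 = (1 - s) * q := by rw [hqdef]; ring
  rw [e1, e2, e3, e4, e5, e6, e7, e8, Real.arctan_neg, Real.log_mul (by positivity) hp.ne',
    Real.log_div hp.ne' (by positivity), Real.log_pow, Real.log_pow]
  have ha := arctan_add_arctan_eq_three_mul hs
  have ha' : Real.arctan ((6 * s - (1 + s) ^ 2) / (√3 * (1 - s ^ 2)))
      = 3 * Real.arctan (√3 * s / (2 - s)) - Real.arctan ((1 + s) ^ 2 / (√3 * (1 - s ^ 2))) := by
    linarith
  rw [ha']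
  generalize Real.arctan (√3 * s / (2 - s)) = A
  generalize Real.log p = B
  generalize Real.log (1 + s) = C
  push_cast
  have e9 : 2 * s * (1 + s) / (√3 * (1 - s) * q) = 2 * √3 * s * (1 + s) / (3 * ((1 - s) * q)) := by
    field_simp
    rw [h3']
  rw [e9]
  have hpq : p = 3 * q - 2 * (1 + s) ^ 2 := by rw [hqdef, hpdef]; ring
  field_simp
  rw [hpq]
  rw [hqdef]
  ring

/-! ### Identification of the series with the closed form. -/

theorem abs_seriesArg_lt {s : ℝ} (h : 4 * |s ^ 3| < (1 + s ^ 3) ^ 2) : |seriesArg s| < 27 / 4 := by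
  have hpos : 0 < (1 + s ^ 3) ^ 2 := (by positivity : 0 ≤ 4 * |s ^ 3|).trans_lt h
  rw [seriesArg, abs_div, abs_mul, abs_of_pos hpos, abs_of_nonneg (by norm_num : (0 : ℝ) ≤ 27),
    div_lt_iff₀ hpos]
  linarith

/-- This keeps the whole segment from 0 to s in the region of convergence. For s³ ≥ 0 the condition
is (1 - s³)² > 0; for s³ < 0, shrinking |s³| lowers the left side and raises the right. -/
theorem convergence_condition_mul {s r : ℝ} (hs : s ∈ Set.Ioo (-1 : ℝ) 1)
    (h : 4 * |s ^ 3| < (1 + s ^ 3) ^ 2) (hr : r ∈ Set.Icc (0 : ℝ) 1) :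
    4 * |(r * s) ^ 3| < (1 + (r * s) ^ 3) ^ 2 := by
  have hr0 : 0 ≤ r ^ 3 := pow_nonneg hr.1 3
  have hr1 : r ^ 3 ≤ 1 := pow_le_one₀ hr.1 hr.2
  rw [mul_pow, abs_mul, abs_of_nonneg hr0]
  have hu : |s ^ 3| < 1 := by
    rw [abs_pow]
    exact pow_lt_one₀ (abs_nonneg s) (abs_lt.2 hs) (by norm_num)
  generalize s ^ 3 = u at *
  generalize r ^ 3 = ρ at *
  rcases le_or_gt 0 u with h0 | h0
  · rw [abs_of_nonneg h0] at *
    have : ρ * u < 1 := (mul_le_of_le_one_left h0 hr1).trans_lt hu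
    nlinarith [mul_pos (sub_pos.2 this) (sub_pos.2 this)]
  · rw [abs_of_neg h0] at *
    have : ρ * (-u) ≤ -u := mul_le_of_le_one_left (by linarith) hr1
    nlinarith

theorem invChooseSeries_seriesArg {s : ℝ} (hs : s ∈ Set.Ioo (-1 : ℝ) 1)
    (h : 4 * |s ^ 3| < (1 + s ^ 3) ^ 2) : invChooseSeries (seriesArg s) = closedForm s := by
  have hmem : ∀ r ∈ Set.Icc (0 : ℝ) 1, r * s ∈ Set.Ioo (-1 : ℝ) 1 := fun r hr => by
    rw [Set.mem_Ioo, ← abs_lt, abs_mul, abs_of_nonneg hr.1]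
    exact (mul_le_of_le_one_left (abs_nonneg s) hr.2).trans_lt (abs_lt.2 hs)
  have hd : ∀ r ∈ Set.Icc (0 : ℝ) 1, HasDerivAt
      (fun r => invChooseSeries (seriesArg (r * s)) - closedForm (r * s)) 0 r := by
    intro r hr
    have hm := hmem r hr
    have hl : HasDerivAt (fun r : ℝ => r * s) s r := by
      simpa using (hasDerivAt_id r).mul_const s
    have h1 := hasDerivAt_invChooseSeries (abs_seriesArg_lt (convergence_condition_mul hs h hr))
    have h2 := hasDerivAt_seriesArg hm.1
    have h3 := hasDerivAt_closedForm (s := r * s) ⟨hm.1, by linarith [hm.2]⟩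
    have h4 := HasDerivAt.comp r (h1.comp (r * s) h2) hl
    refine (h4.sub (HasDerivAt.comp r h3 hl)).congr_deriv ?_
    have key := seriesArg_mul_integral hm
    have hc := one_add_cube_pos hm.1
    generalize r * s = t at *
    have ht : 0 < 1 - t ^ 3 := by
      have : 1 - t ^ 3 = (1 - t) * (1 + t + t ^ 2) := by ring
      rw [this]
      exact mul_pos (by linarith [hm.2]) (by nlinarith [sq_nonneg (t + 1)])
    rw [← sub_mul, sub_eq_zero.2, zero_mul]
    -- `key` evaluates x times the integral, and t·x'(t) = 3(1-t³)/(1+t³)·x(t). Matching the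
    -- derivatives therefore costs a factor t, and t = 0 is separate.
    rcases eq_or_ne t 0 with rfl | h0
    · simp
    · apply mul_left_cancel₀ h0
      have e1 : t * (81 * t ^ 2 * (1 - t ^ 3) / (1 + t ^ 3) ^ 3)
          = 3 * (1 - t ^ 3) / (1 + t ^ 3) * seriesArg t := by
        rw [seriesArg]; field_simp; ring
      rw [mul_left_comm, e1, mul_left_comm, mul_comm _ (seriesArg t), key]
      field_simp
  have hconst := constant_of_has_deriv_right_zero (a := (0 : ℝ)) (b := 1)
    (fun r hr => (hd r hr).continuousAt.continuousWithinAt)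
    (fun r hr => (hd r ⟨hr.1, hr.2.le⟩).hasDerivWithinAt) 1 ⟨zero_le_one, le_rfl⟩
  have h0 : invChooseSeries (seriesArg 0) - closedForm 0 = 0 := by
    simp [invChooseSeries, seriesArg, closedForm]
  simp only [one_mul, zero_mul, h0] at hconst
  linarith

theorem hasSum_closedForm_of_lt {s : ℝ} (hs : s ∈ Set.Ioo (-1 : ℝ) 1)
    (h : 4 * |s ^ 3| < (1 + s ^ 3) ^ 2) :
    HasSum (fun j : ℕ => invChooseCoeff j * seriesArg s ^ (j + 1)) (closedForm s) := by
  rw [← invChooseSeries_seriesArg hs h]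
  exact (summable_invChooseCoeff (abs_seriesArg_lt h)).hasSum

-- At x = 27/4 the denominator has a double zero at y = 2/3, so the derivative formula is
-- unavailable. The terms are nonnegative: partial sums are limits, as s → 1⁻, of partial sums
-- bounded by `closedForm s`, while `closedForm s` is at most the sum at 1 because `seriesArg s ≤
-- seriesArg 1`.
open Filter Topology in
theorem hasSum_closedForm_one :
    HasSum (fun j : ℕ => invChooseCoeff j * seriesArg 1 ^ (j + 1)) (closedForm 1) := by
  have hG : Tendsto seriesArg (𝓝[<] 1) (𝓝 (seriesArg 1)) :=
    (hasDerivAt_seriesArg (by norm_num)).continuousAt.tendsto.mono_left nhdsWithin_le_nhds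
  have hF : Tendsto closedForm (𝓝[<] 1) (𝓝 (closedForm 1)) :=
    (hasDerivAt_closedForm ⟨by norm_num, by norm_num⟩).continuousAt.tendsto.mono_left
      nhdsWithin_le_nhds
  have hev : ∀ᶠ s : ℝ in 𝓝[<] 1, s ∈ Set.Ioo (0 : ℝ) 1 := Ioo_mem_nhdsLT zero_lt_one
  have hs : ∀ s ∈ Set.Ioo (0 : ℝ) 1,
      HasSum (fun j : ℕ => invChooseCoeff j * seriesArg s ^ (j + 1)) (closedForm s) := by
    intro s hs
    refine hasSum_closedForm_of_lt ⟨by linarith [hs.1], hs.2⟩ ?_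
    have h0 : 0 < s ^ 3 := pow_pos hs.1 3
    have h1 : s ^ 3 < 1 := pow_lt_one₀ hs.1.le hs.2 (by norm_num)
    rw [abs_of_pos h0]
    nlinarith [mul_pos (sub_pos.2 h1) (sub_pos.2 h1)]
  have hnn : ∀ s : ℝ, 0 ≤ s → ∀ j : ℕ, 0 ≤ invChooseCoeff j * seriesArg s ^ (j + 1) := by
    intro s hs j
    have := invChooseCoeff_nonneg j
    rw [seriesArg]
    positivity
  have hle : ∀ s ∈ Set.Ioo (0 : ℝ) 1, seriesArg s ≤ seriesArg 1 := by
    intro s hs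
    have : 0 < s ^ 3 := pow_pos hs.1 3
    rw [seriesArg, seriesArg, div_le_div_iff₀ (by positivity) (by norm_num)]
    nlinarith [sq_nonneg (1 - s ^ 3)]
  have hpartial : ∀ N : ℕ, ∑ j ∈ Finset.range N, invChooseCoeff j * seriesArg 1 ^ (j + 1)
      ≤ closedForm 1 := by
    intro N
    refine le_of_tendsto_of_tendsto
      (tendsto_finsetSum _ fun j _ => (hG.pow (j + 1)).const_mul (invChooseCoeff j)) hF ?_
    filter_upwards [hev] with s hs'
    exact sum_le_hasSum _ (fun j _ => hnn s hs'.1.le j) (hs s hs')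
  have hsum : Summable fun j : ℕ => invChooseCoeff j * seriesArg 1 ^ (j + 1) :=
    summable_of_sum_range_le (hnn 1 zero_le_one) hpartial
  have hup := Real.tsum_le_of_sum_range_le (hnn 1 zero_le_one) hpartial
  have hlow : closedForm 1 ≤ ∑' j : ℕ, invChooseCoeff j * seriesArg 1 ^ (j + 1) := by
    refine le_of_tendsto hF ?_
    filter_upwards [hev] with s hs'
    rw [← (hs s hs').tsum_eq]
    refine (hs s hs').summable.tsum_le_tsum (fun j => ?_) hsum
    refine mul_le_mul_of_nonneg_left (pow_le_pow_left₀ ?_ (hle s hs') _) (invChooseCoeff_nonneg j)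
    have := hs'.1
    rw [seriesArg]
    positivity
  rw [← le_antisymm hup hlow]
  exact hsum.hasSum

/-! ### The sum in terms of cube roots. -/

theorem cbrt_pow_three {x : ℝ} (hx : 0 ≤ x) : cbrt x ^ 3 = x := by
  rw [cbrt, ← Real.rpow_natCast, ← Real.rpow_mul hx]
  norm_num

theorem cbrt_nonneg {x : ℝ} (hx : 0 ≤ x) : 0 ≤ cbrt x := Real.rpow_nonneg hx _

/-- The series in terms of two numbers `A`, `B` whose cube roots appear in the closed form. -/
theorem hasSum_of_cbrt {A B ε : ℝ} (hA : 0 < A) (hB : 0 ≤ B) (hε : ε = 1 ∨ ε = -1)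
    (hpos : ε = 1 → B ≤ A) (hneg : ε = -1 → 6 * B ≤ A) :
    HasSum (fun k : ℕ+ => ε ^ (k : ℕ) / ((k : ℝ) ^ 2 * (Nat.choose (3 * k) k : ℝ)) *
        (27 * A * B / (A + ε * B) ^ 2) ^ (k : ℕ))
      (6 * Real.arctan (√3 * cbrt B / (2 * cbrt A - ε * cbrt B)) ^ 2
        - 1 / 2 * Real.log ((A + ε * B) / (cbrt A + ε * cbrt B) ^ 3) ^ 2) := by
  have ha3 := cbrt_pow_three hA.le
  have hb3 := cbrt_pow_three hB
  have ha : 0 < cbrt A := Real.rpow_pos_of_pos hA _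
  have hb := cbrt_nonneg hB
  have hε2 : ε ^ 2 = 1 := by rcases hε with rfl | rfl <;> norm_num
  have hε3 : ε ^ 3 = ε := by rw [pow_succ, hε2, one_mul]
  have hAB : 0 < A + ε * B := by
    rcases hε with rfl | rfl
    · positivity
    · have := hneg rfl
      linarith
  obtain ⟨s, hsdef⟩ : ∃ s, s = ε * cbrt B / cbrt A := ⟨_, rfl⟩
  have hs3 : s ^ 3 = ε * B / A := by rw [hsdef, div_pow, mul_pow, hε3, ha3, hb3]
  have hs3' : A * (1 + s ^ 3) = A + ε * B := by rw [hs3]; field_simp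
  have hx : seriesArg s = ε * (27 * A * B / (A + ε * B) ^ 2) := by
    rw [← hs3', seriesArg, hs3]
    have : 1 + ε * B / A ≠ 0 := by
      intro h0
      rw [hs3, h0, mul_zero] at hs3'
      exact hAB.ne hs3'
    field_simp
  have hsum : HasSum (fun j : ℕ => invChooseCoeff j * seriesArg s ^ (j + 1)) (closedForm s) := by
    have habs : |s ^ 3| = B / A := by
      rw [hs3, abs_div, abs_mul, abs_of_nonneg hB, abs_of_pos hA]
      rcases hε with rfl | rfl <;> norm_num
    have hcond : B < A → 4 * B * A < (A + ε * B) ^ 2 →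
        HasSum (fun j : ℕ => invChooseCoeff j * seriesArg s ^ (j + 1)) (closedForm s) := by
      intro hlt h4
      refine hasSum_closedForm_of_lt (abs_lt.1 ?_) ?_
      · refine lt_of_pow_lt_pow_left₀ 3 zero_le_one ?_
        rw [← abs_pow, habs, one_pow, div_lt_one hA]
        exact hlt
      · rw [← hs3'] at h4
        rw [habs, ← mul_div_assoc, div_lt_iff₀ hA]
        refine lt_of_mul_lt_mul_right (lt_of_lt_of_eq h4 ?_) hA.le
        ring
    rcases hε with rfl | rfl
    · rcases (hpos rfl).lt_or_eq with hlt | heq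
      · refine hcond hlt ?_
        nlinarith [mul_pos (sub_pos.2 hlt) (sub_pos.2 hlt)]
      · have : s = 1 := by rw [hsdef, heq, one_mul, div_self ha.ne']
        rw [this]
        exact hasSum_closedForm_one
    · have := hneg rfl
      refine hcond (by linarith) ?_
      rcases hB.eq_or_lt with h0 | h0
      · rw [← h0]; simp; positivity
      -- (A-B)² - 4AB = A(A-6B) + B².
      · nlinarith [mul_nonneg hA.le (sub_nonneg.2 this), mul_pos h0 h0]
  have hval : 6 * Real.arctan (√3 * cbrt B / (2 * cbrt A - ε * cbrt B)) ^ 2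
        - 1 / 2 * Real.log ((A + ε * B) / (cbrt A + ε * cbrt B) ^ 3) ^ 2 = closedForm s := by
    have hsa : s * cbrt A = ε * cbrt B := by rw [hsdef]; field_simp
    -- The sign ε leaves the arctangent by oddness and disappears in the square.
    have e1 : √3 * s / (2 - s) = ε * (√3 * cbrt B / (2 * cbrt A - ε * cbrt B)) := by
      rw [← mul_div_mul_right _ _ ha.ne', sub_mul, mul_assoc √3, hsa]
      ring
    have e2 : (1 + s ^ 3) / (1 + s) ^ 3 = (A + ε * B) / (cbrt A + ε * cbrt B) ^ 3 := by
      have : cbrt A + ε * cbrt B = cbrt A * (1 + s) := by rw [← hsa]; ring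
      rw [this, mul_pow, ha3, ← hs3', mul_div_mul_left _ _ hA.ne']
    rw [closedForm, e1, e2]
    rcases hε with rfl | rfl
    · rw [one_mul (√3 * cbrt B / _)]
    · rw [neg_one_mul (√3 * cbrt B / _), Real.arctan_neg, neg_sq]
  -- Reindexing by k = j + 1.
  rw [hval, ← Equiv.pnatEquivNat.symm.hasSum_iff]
  refine hsum.congr_fun fun j => ?_
  simp only [Function.comp_apply, Equiv.pnatEquivNat_symm_apply, Nat.succPNat_coe, invChooseCoeff,
    Nat.succ_eq_add_one]
  rw [hx, mul_pow]
  push_cast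
  ring

theorem hasSum_of_cbrt_neg_one_pow {A B C : ℝ} (e : ℕ) (hA : 0 < A) (hB : 0 ≤ B)
    (hC : A + (-1) ^ e * B = C) (hpos : Even e → B ≤ A) (hneg : Odd e → 6 * B ≤ A) :
    HasSum (fun k : ℕ+ => (-1 : ℝ) ^ ((k : ℕ) * e) / ((k : ℝ) ^ 2 * (Nat.choose (3 * k) k : ℝ)) *
        (27 * A * B / C ^ 2) ^ (k : ℕ))
      (6 * Real.arctan (√3 * cbrt B / (2 * cbrt A - (-1) ^ e * cbrt B)) ^ 2
        - 1 / 2 * Real.log (C / (cbrt A + (-1) ^ e * cbrt B) ^ 3) ^ 2) := by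
  subst hC
  simp only [mul_comm _ e, pow_mul]
  refine hasSum_of_cbrt hA hB (neg_one_pow_eq_or ℝ e) (fun h => hpos ?_) (fun h => hneg ?_)
  · exact (neg_one_pow_eq_one_iff_even (by norm_num)).1 h
  · by_contra h'
    rw [Nat.not_odd_iff_even] at h'
    rw [h'.neg_one_pow] at h
    norm_num at h

/-! ### Fibonacci and Lucas identities. -/

open Real in
theorem fibR_eq_sub_div (j : ℕ) : fibR j = (goldenRatio ^ j - goldenConj ^ j) / √5 := coe_fib_eq j

theorem fibR_add_two (j : ℕ) : fibR (j + 2) = fibR (j + 1) + fibR j := by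
  simp only [fibR, Nat.fib_add_two]; push_cast; ring

theorem lucR_add_two (j : ℕ) : lucR (j + 2) = lucR (j + 1) + lucR j := by
  simp only [lucR, lucasNat]; push_cast; ring

theorem fibR_zero : fibR 0 = 0 := by simp [fibR]

theorem lucR_zero : lucR 0 = 2 := by simp [lucR, lucasNat]

theorem lucR_one : lucR 1 = 1 := by simp [lucR, lucasNat]

open Real in
theorem lucR_eq_add : ∀ j : ℕ, lucR j = goldenRatio ^ j + goldenConj ^ j
  | 0 => by rw [lucR_zero]; norm_num
  | 1 => by rw [lucR_one, pow_one, pow_one, goldenRatio_add_goldenConj]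
  | j + 2 => by
    rw [lucR_add_two, lucR_eq_add (j + 1), lucR_eq_add j, pow_add goldenRatio j 2,
      pow_add goldenConj j 2, goldenRatio_sq, goldenConj_sq]
    ring

-- With signs written this way, the identities below become polynomial identities in powers of the
-- two roots, and `ring` proves them.
open Real in
theorem neg_one_pow_eq_goldenRatio_mul (m : ℕ) :
    (-1 : ℝ) ^ m = goldenRatio ^ m * goldenConj ^ m := by
  rw [← mul_pow, goldenRatio_mul_goldenConj]

/-- Here and below n = m + d, so that n - m is d and no truncated subtraction occurs. -/
theorem fibR_sq_sub (m d : ℕ) :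
    fibR (m + d) ^ 2 - (-1) ^ d * fibR m ^ 2 = fibR d * fibR (m + d + m) := by
  simp only [fibR_eq_sub_div, neg_one_pow_eq_goldenRatio_mul, pow_add]
  ring

theorem fibR_add_neg_one_pow_mul (m d : ℕ) :
    fibR (m + d + m) + (-1) ^ m * fibR d = lucR m * fibR (m + d) := by
  simp only [fibR_eq_sub_div, lucR_eq_add, neg_one_pow_eq_goldenRatio_mul, pow_add]
  ring

theorem fibR_sub_neg_one_pow_mul (m d : ℕ) :
    fibR (m + d + m) - (-1) ^ m * fibR d = fibR m * lucR (m + d) := by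
  simp only [fibR_eq_sub_div, lucR_eq_add, neg_one_pow_eq_goldenRatio_mul, pow_add]
  ring

theorem lucR_mul_fibR_add (m n : ℕ) :
    lucR n * fibR m + lucR m * fibR n = 2 * fibR (n + m) := by
  simp only [fibR_eq_sub_div, lucR_eq_add, pow_add]
  ring

theorem fibR_two_mul (n : ℕ) : fibR (2 * n) = fibR n * lucR n := by
  simp only [fibR_eq_sub_div, lucR_eq_add, two_mul, pow_add]
  ring

theorem lucR_add_neg_one_pow_mul (m d : ℕ) :
    lucR (m + d + m) + (-1) ^ m * lucR d = lucR m * lucR (m + d) := by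
  simp only [lucR_eq_add, neg_one_pow_eq_goldenRatio_mul, pow_add]
  ring

theorem lucR_sub_neg_one_pow_mul (m d : ℕ) :
    lucR (m + d + m) - (-1) ^ m * lucR d = 5 * fibR m * fibR (m + d) := by
  have h5 : (√5 : ℝ) ^ 2 = 5 := Real.sq_sqrt (by norm_num)
  have h0 : (√5 : ℝ) ≠ 0 := by positivity
  have h : ∀ a b : ℝ, 5 * (a / √5) * (b / √5) = a * b := fun a b => by
    field_simp
    rw [h5]
    ring
  simp only [fibR_eq_sub_div, lucR_eq_add, neg_one_pow_eq_goldenRatio_mul, h, pow_add]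
  ring

/-! ### Positivity and growth estimates. -/

theorem fibR_nonneg (j : ℕ) : 0 ≤ fibR j := Nat.cast_nonneg _

theorem fibR_pos {j : ℕ} (h : 0 < j) : 0 < fibR j := Nat.cast_pos.2 (Nat.fib_pos.2 h)

theorem fibR_mono : Monotone fibR := fun _ _ h => Nat.cast_le.2 (Nat.fib_mono h)

theorem lucR_nonneg (j : ℕ) : 0 ≤ lucR j := Nat.cast_nonneg _

theorem lucR_pos : ∀ j : ℕ, 0 < lucR j
  | 0 => by rw [lucR_zero]; norm_num
  | 1 => by rw [lucR_one]; norm_num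
  | j + 2 => by rw [lucR_add_two]; linarith [lucR_pos (j + 1), lucR_pos j]

theorem lucR_add_one_le_add_two (j : ℕ) : lucR (j + 1) ≤ lucR (j + 2) := by
  rw [lucR_add_two]; linarith [lucR_pos j]

theorem lucR_le_two_mul : ∀ j : ℕ, lucR j ≤ 2 * lucR (j + 1)
  | 0 => by rw [lucR_zero, lucR_one]; norm_num
  | j + 1 => by rw [lucR_add_two]; linarith [lucR_pos j, lucR_pos (j + 1)]

theorem fibR_le_add_one (j : ℕ) : fibR j ≤ fibR (j + 1) := fibR_mono (Nat.le_succ j)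

/-- The shift by 2 avoids the initial descent L₀ = 2 > 1 = L₁. -/
theorem lucR_le_add (j e : ℕ) : lucR (j + 2) ≤ lucR (j + e + 2) := by
  induction e with
  | zero => rfl
  | succ e ih => exact ih.trans (lucR_add_one_le_add_two (j + e + 1))

theorem lucR_le_add_two_mul {m : ℕ} (hm : 0 < m) (d : ℕ) : lucR d ≤ lucR (m + d + m) := by
  obtain ⟨r, rfl⟩ : ∃ r, m = r + 1 := ⟨m - 1, by omega⟩
  have h := lucR_le_add d (2 * r)
  rw [show d + 2 * r + 2 = r + 1 + d + (r + 1) by ring, lucR_add_two] at h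
  linarith [lucR_pos (d + 1)]

/-- The ratio 5/2 exceeds √6, so squaring gives 6F_m² ≤ F_{m+d}². The excluded pair has F₃/F₁ = 2.
-/
theorem five_mul_fibR_le {m d : ℕ} (hm : 0 < m) (hd : 0 < d) (he : Even d)
    (h : ¬ (m = 1 ∧ d = 2)) : 5 * fibR m ≤ 2 * fibR (m + d) := by
  rcases Nat.lt_or_ge d 4 with h4 | h4
  · have hd2 : d = 2 := by rcases he with ⟨r, rfl⟩; omega
    subst hd2
    obtain ⟨j, rfl⟩ : ∃ j, m = j + 2 := ⟨m - 2, by omega⟩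
    rw [fibR_add_two (j + 2), fibR_add_two (j + 1), fibR_add_two j]
    linarith [fibR_le_add_one j]
  · have h1 := fibR_mono (show m + 4 ≤ m + d by omega)
    rw [fibR_add_two (m + 2), fibR_add_two (m + 1), fibR_add_two m] at h1
    linarith [fibR_le_add_one m, fibR_nonneg m]

theorem six_mul_fibR_le_of_three_le {m d : ℕ} (hm : 3 ≤ m) : 6 * fibR d ≤ fibR (m + d + m) := by
  have h1 := fibR_mono (show d + 6 ≤ m + d + m by omega)
  rw [fibR_add_two (d + 4), fibR_add_two (d + 3), fibR_add_two (d + 2), fibR_add_two (d + 1),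
    fibR_add_two d] at h1
  linarith [fibR_le_add_one d, fibR_nonneg d]

/-- F_{d+4} = 3F_{d+1} + 2F_d, so 3F_{d+1} ≥ 4F_d is needed. It fails only at d = 1, which is the
pair (n, m) = (3, 2). -/
theorem six_mul_fibR_le_of_ne_one {d : ℕ} (hd : d ≠ 1) : 6 * fibR d ≤ fibR (2 + d + 2) := by
  rcases Nat.eq_zero_or_pos d with rfl | h
  · rw [fibR_zero, mul_zero]; exact fibR_nonneg _
  · obtain ⟨j, rfl⟩ : ∃ j, d = j + 2 := ⟨d - 2, by omega⟩
    rw [show 2 + (j + 2) + 2 = j + 4 + 2 by ring, fibR_add_two (j + 4), fibR_add_two (j + 3),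
      fibR_add_two (j + 2), fibR_add_two (j + 1), fibR_add_two j]
    linarith [fibR_le_add_one j, fibR_nonneg j]

theorem six_mul_lucR_le_of_three_le {m d : ℕ} (hm : 3 ≤ m) : 6 * lucR d ≤ lucR (m + d + m) := by
  have h1 := lucR_le_add (d + 4) (2 * (m - 3))
  rw [show d + 4 + 2 * (m - 3) + 2 = m + d + m by omega, lucR_add_two (d + 4), lucR_add_two (d + 3),
    lucR_add_two (d + 2), lucR_add_two (d + 1), lucR_add_two d] at h1
  linarith [lucR_le_two_mul d, lucR_pos (d + 1)]

/-- At d = 0, the pair (2, 2), the bound fails: L₄ = 7 < 12 = 6L₀. -/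
theorem six_mul_lucR_le_of_pos {d : ℕ} (hd : 0 < d) : 6 * lucR d ≤ lucR (2 + d + 2) := by
  obtain ⟨j, rfl⟩ : ∃ j, d = j + 1 := ⟨d - 1, by omega⟩
  rw [show 2 + (j + 1) + 2 = j + 3 + 2 by ring, lucR_add_two (j + 3), lucR_add_two (j + 2),
      lucR_add_two (j + 1), lucR_add_two j]
  rcases Nat.eq_zero_or_pos j with rfl | h
  · rw [zero_add, lucR_zero, lucR_one]; norm_num
  · obtain ⟨i, rfl⟩ : ∃ i, j = i + 1 := ⟨j - 1, by omega⟩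
    rw [lucR_add_two i]
    linarith [lucR_le_two_mul i]

theorem neg_one_pow_sub_one {m : ℕ} (hm : 0 < m) : (-1 : ℝ) ^ (m - 1) = -(-1) ^ m := by
  obtain ⟨r, rfl⟩ : ∃ r, m = r + 1 := ⟨m - 1, by omega⟩
  rw [Nat.add_sub_cancel, pow_succ]
  ring

/-! ### The six families. `HasSum` over `ℕ+` in ℝ is unconditional, hence absolute, convergence. -/

theorem theorem3 (m n : ℕ) (hm : 0 < m) (hn : 0 < n) :
    (m < n → (n, m) ≠ (3, 1) →
      HasSum (fun k : ℕ+ =>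
          (-1 : ℝ) ^ ((k : ℕ) * (n - m - 1)) / ((k : ℝ) ^ 2 * (Nat.choose (3 * k) k : ℝ)) *
            (27 * fibR n ^ 2 * fibR m ^ 2 / (fibR (n - m) ^ 2 * fibR (n + m) ^ 2)) ^ (k : ℕ))
        (6 * Real.arctan (√3 * cbrt (fibR m ^ 2) / (2 * cbrt (fibR n ^ 2) + (-1) ^ (n - m) * cbrt (fibR m ^ 2))) ^ 2
          - 1 / 2 * Real.log (fibR (n - m) * fibR (n + m) / (cbrt (fibR n ^ 2) - (-1) ^ (n - m) * cbrt (fibR m ^ 2)) ^ 3) ^ 2)) ∧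
    (m ≤ n → (m = 1 → n = 1) →
      HasSum (fun k : ℕ+ =>
          (-1 : ℝ) ^ ((k : ℕ) * m) / ((k : ℝ) ^ 2 * (Nat.choose (3 * k) k : ℝ)) *
            (27 * fibR (n + m) * fibR (n - m) / (lucR m ^ 2 * fibR n ^ 2)) ^ (k : ℕ))
        (6 * Real.arctan (√3 * cbrt (fibR (n - m)) / (2 * cbrt (fibR (n + m)) - (-1) ^ m * cbrt (fibR (n - m)))) ^ 2
          - 1 / 2 * Real.log (lucR m * fibR n / (cbrt (fibR (n + m)) + (-1) ^ m * cbrt (fibR (n - m))) ^ 3) ^ 2)) ∧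
    (m ≤ n → (n, m) ≠ (3, 2) →
      HasSum (fun k : ℕ+ =>
          (-1 : ℝ) ^ ((k : ℕ) * (m - 1)) / ((k : ℝ) ^ 2 * (Nat.choose (3 * k) k : ℝ)) *
            (27 * fibR (n + m) * fibR (n - m) / (fibR m ^ 2 * lucR n ^ 2)) ^ (k : ℕ))
        (6 * Real.arctan (√3 * cbrt (fibR (n - m)) / (2 * cbrt (fibR (n + m)) + (-1) ^ m * cbrt (fibR (n - m)))) ^ 2
          - 1 / 2 * Real.log (fibR m * lucR n / (cbrt (fibR (n + m)) - (-1) ^ m * cbrt (fibR (n - m))) ^ 3) ^ 2)) ∧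
    (fibR n / fibR m < lucR n / lucR m →
      HasSum (fun k : ℕ+ =>
          1 / ((k : ℝ) ^ 2 * (Nat.choose (3 * k) k : ℝ)) *
            (27 / 4 * (fibR (2 * m) * fibR (2 * n) / fibR (n + m) ^ 2)) ^ (k : ℕ))
        (6 * Real.arctan (√3 * cbrt (lucR m * fibR n) / (2 * cbrt (lucR n * fibR m) - cbrt (lucR m * fibR n))) ^ 2
          - 1 / 2 * Real.log (2 * fibR (n + m) / (cbrt (lucR n * fibR m) + cbrt (lucR m * fibR n)) ^ 3) ^ 2)) ∧
    (m ≤ n → m ≠ 1 →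
      HasSum (fun k : ℕ+ =>
          (-1 : ℝ) ^ ((k : ℕ) * m) / ((k : ℝ) ^ 2 * (Nat.choose (3 * k) k : ℝ)) *
            (27 * lucR (n + m) * lucR (n - m) / (lucR m ^ 2 * lucR n ^ 2)) ^ (k : ℕ))
        (6 * Real.arctan (√3 * cbrt (lucR (n - m)) / (2 * cbrt (lucR (n + m)) - (-1) ^ m * cbrt (lucR (n - m)))) ^ 2
          - 1 / 2 * Real.log (lucR m * lucR n / (cbrt (lucR (n + m)) + (-1) ^ m * cbrt (lucR (n - m))) ^ 3) ^ 2)) ∧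
    (m ≤ n → (n, m) ≠ (2, 2) →
      HasSum (fun k : ℕ+ =>
          (-1 : ℝ) ^ ((k : ℕ) * (m - 1)) / ((k : ℝ) ^ 2 * (Nat.choose (3 * k) k : ℝ)) *
            (27 * lucR (n + m) * lucR (n - m) / (25 * fibR m ^ 2 * fibR n ^ 2)) ^ (k : ℕ))
        (6 * Real.arctan (√3 * cbrt (lucR (n - m)) / (2 * cbrt (lucR (n + m)) + (-1) ^ m * cbrt (lucR (n - m)))) ^ 2
          - 1 / 2 * Real.log (5 * fibR m * fibR n / (cbrt (lucR (n + m)) - (-1) ^ m * cbrt (lucR (n - m))) ^ 3) ^ 2)) := by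
  refine ⟨fun hlt hne => ?_, fun hle h1 => ?_, fun hle hne => ?_, fun hlt => ?_, fun hle hne => ?_,
    fun hle hne => ?_⟩
  · obtain ⟨d, rfl⟩ := Nat.exists_eq_add_of_le hlt.le
    rw [Nat.add_sub_cancel_left]
    have hd : 0 < d := by omega
    have hs := neg_one_pow_sub_one hd
    have h := hasSum_of_cbrt_neg_one_pow (A := fibR (m + d) ^ 2) (B := fibR m ^ 2)
      (C := fibR d * fibR (m + d + m)) (d - 1) (pow_pos (fibR_pos hn) 2) (sq_nonneg _)
      (by rw [hs, ← fibR_sq_sub]; ring)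
      -- Equality F₁ = F₂ occurs at (n, m) = (2, 1), which is where the endpoint s = 1 is needed.
      (fun _ => pow_le_pow_left₀ (fibR_nonneg m) (fibR_mono (by omega)) 2)
      (fun ho => by
        have he : Even d := by
          obtain ⟨r, hr⟩ := ho
          exact ⟨r + 1, by omega⟩
        have h5 := five_mul_fibR_le hm hd he fun h => hne (by rw [h.1, h.2])
        have := fibR_nonneg m
        nlinarith)
    rw [hs, neg_mul, sub_neg_eq_add, ← sub_eq_add_neg] at h
    simpa only [mul_pow] using h
  · obtain ⟨d, rfl⟩ := Nat.exists_eq_add_of_le hle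
    rw [Nat.add_sub_cancel_left]
    have h := hasSum_of_cbrt_neg_one_pow (A := fibR (m + d + m)) (B := fibR d)
      (C := lucR m * fibR (m + d)) m (fibR_pos (by omega)) (fibR_nonneg d)
      (fibR_add_neg_one_pow_mul m d) (fun _ => fibR_mono (by omega))
      (fun ho => by
        rcases Nat.lt_or_ge m 3 with h3 | h3
        · have hm1 : m = 1 := by rcases ho with ⟨r, rfl⟩; omega
          -- For m = 1 only n = 1 is admitted; then B = F₀ = 0 and the bound is trivial.
          have hd0 : d = 0 := by have := h1 hm1; omega
          rw [hd0, fibR_zero, mul_zero]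
          exact fibR_nonneg _
        · exact six_mul_fibR_le_of_three_le h3)
    simpa only [mul_pow] using h
  · obtain ⟨d, rfl⟩ := Nat.exists_eq_add_of_le hle
    rw [Nat.add_sub_cancel_left]
    have hs := neg_one_pow_sub_one hm
    have h := hasSum_of_cbrt_neg_one_pow (A := fibR (m + d + m)) (B := fibR d)
      (C := fibR m * lucR (m + d)) (m - 1) (fibR_pos (by omega)) (fibR_nonneg d)
      (by rw [hs, ← fibR_sub_neg_one_pow_mul]; ring) (fun _ => fibR_mono (by omega))
      (fun ho => by
        rcases Nat.lt_or_ge m 3 with h3 | h3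
        · have hm2 : m = 2 := by
            obtain ⟨r, hr⟩ := ho
            omega
          subst hm2
          exact six_mul_fibR_le_of_ne_one fun h => hne (by rw [h])
        · exact six_mul_fibR_le_of_three_le h3)
    rw [hs, neg_mul, sub_neg_eq_add, ← sub_eq_add_neg] at h
    simpa only [mul_pow] using h
  · have hB : lucR m * fibR n ≤ lucR n * fibR m := by
      rw [div_lt_div_iff₀ (fibR_pos hm) (lucR_pos m)] at hlt
      linarith
    -- Exponent 0 means ε = 1. The product AB is F_{2m}F_{2n}, and C = 2F_{n+m} accounts for the
    -- factor 27/4.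
    have h := hasSum_of_cbrt_neg_one_pow (A := lucR n * fibR m) (B := lucR m * fibR n)
      (C := 2 * fibR (n + m)) 0 (mul_pos (lucR_pos n) (fibR_pos hm))
      (mul_nonneg (lucR_nonneg m) (fibR_nonneg n))
      (by rw [pow_zero, one_mul, lucR_mul_fibR_add]) (fun _ => hB)
      (fun ho => absurd ho (by decide))
    simp only [mul_zero, pow_zero, one_mul] at h
    refine h.congr_fun fun k => ?_
    rw [fibR_two_mul, fibR_two_mul]
    congr 2
    ring
  · obtain ⟨d, rfl⟩ := Nat.exists_eq_add_of_le hle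
    rw [Nat.add_sub_cancel_left]
    have h := hasSum_of_cbrt_neg_one_pow (A := lucR (m + d + m)) (B := lucR d)
      (C := lucR m * lucR (m + d)) m (lucR_pos _) (lucR_nonneg d)
      (lucR_add_neg_one_pow_mul m d) (fun _ => lucR_le_add_two_mul hm d)
      (fun ho => six_mul_lucR_le_of_three_le (by
        rcases ho with ⟨r, rfl⟩
        omega))
    simpa only [mul_pow] using h
  · obtain ⟨d, rfl⟩ := Nat.exists_eq_add_of_le hle
    rw [Nat.add_sub_cancel_left]
    have hs := neg_one_pow_sub_one hm
    have h := hasSum_of_cbrt_neg_one_pow (A := lucR (m + d + m)) (B := lucR d)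
      (C := 5 * fibR m * fibR (m + d)) (m - 1) (lucR_pos _) (lucR_nonneg d)
      (by rw [hs, ← lucR_sub_neg_one_pow_mul]; ring) (fun _ => lucR_le_add_two_mul hm d)
      (fun ho => by
        rcases Nat.lt_or_ge m 3 with h3 | h3
        · have hm2 : m = 2 := by
            obtain ⟨r, hr⟩ := ho
            omega
          subst hm2
          refine six_mul_lucR_le_of_pos (Nat.pos_of_ne_zero fun h => hne (by rw [h]))
        · exact six_mul_lucR_le_of_three_le h3)
    rw [hs, neg_mul, sub_neg_eq_add, ← sub_eq_add_neg] at h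
    refine h.congr_fun fun k => ?_
    congr 3
    ring
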